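/- Let $\mathbb{D}=\{z\in\mathbb{C}:|z|<1\}$ and let $Bel(\mathbb{D})$ be the Banach space $L^\infty(\mathbb{D})$ of essentially bounded measurable complex functions (Beltrami differentials) on $\mathbb{D}$, two functions that agree almost everywhere being identified. Let $Q(\mathbb{D})$ be the space of holomorphic functions $\varphi$ on $\mathbb{D}$ with $\iint_{\mathbb{D}}|\varphi|\,dx\,dy<\infty$. Call $\mu,\nu\in Bel(\mathbb{D})$ equivalent if $\iint_{\mathbb{D}}(\mu-\nu)\varphi\,dx\,dy=0$ for all $\varphi\in Q(\mathbb{D})$, and let $[\mu]_Z$ be the equivalence class of $\mu$. For $\mu\in Bel(\mathbb{D})$ say that - $\mu$ is extremal if $\|\mu\|_\infty=\inf\{\|\nu\|_\infty:\nu\in[\mu]_Z\}$; - $\mu$ is non-decreasable if, whenever $\nu\in[\mu]_Z$ and $|\nu(z)|\le|\mu(z)|$ for almost every $z\in\mathbb{D}$, then $\nu=\mu$; - $\mu$ is strongly decreasable if there are $\nu\in[\mu]_Z$, a domain (nonempty connected open set) $G\subset\mathbb{D}$ and $\delta>0$ such that $|\nu(z)|\le|\mu(z)|$ for almost every $z\in\mathbb{D}$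 and $|\nu(z)|\le|\mu(z)|-\delta$ for almost every $z\in G$; - $\mu$ is pseudo non-decreasable if it is neither strongly decreasable nor non-decreasable. Then there exists $\mu\in Bel(\mathbb{D})$ such that $\mu$ is extremal and non-decreasable, $\mu$ is the only element of $[\mu]_Z$ that is both extremal and non-decreasable, and $[\mu]_Z$ contains infinitely many elements that are both extremal and pseudo non-decreasable. -/

import Mathlib

open MeasureTheory

/-- `Bel S`: the Banach space of Beltrami differentials on `S`, i.e. essentially bounded measurable
complex functions on `S` modulo equality almost everywhere (Lebesgue measure `dx dy`), with the
`L^∞` norm. -/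
abbrev Bel (S : Set ℂ) : Type := Lp ℂ ⊤ (volume.restrict S)

/-- `Q S`: the integrable holomorphic quadratic differentials on `S`. The values of `φ` off `S`
play no role. -/
def Q (S : Set ℂ) : Set (ℂ → ℂ) :=
  {φ | DifferentiableOn ℂ φ S ∧ IntegrableOn φ S volume}

/-- Infinitesimal Teichmüller equivalence: `∬_S (μ - ν) φ dx dy = 0` for every `φ ∈ Q S`. -/
def InfEquiv {S : Set ℂ} (μ ν : Bel S) : Prop :=
  ∀ φ ∈ Q S, ∫ z in S, (μ z - ν z) * φ z = 0

/-- The infinitesimal equivalence class `[μ]_Z` of `μ`. -/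
def infClass {S : Set ℂ} (μ : Bel S) : Set (Bel S) :=
  {ν | InfEquiv μ ν}

/-- The norm of the point `[μ]_Z` of the infinitesimal Teichmüller space: the infimum of
`‖ν‖_∞` over all `ν` in the class. -/
noncomputable def infNorm {S : Set ℂ} (μ : Bel S) : ℝ :=
  sInf ((fun ν : Bel S => ‖ν‖) '' infClass μ)

/-- `μ` is extremal (in its class). -/
def IsExtremal {S : Set ℂ} (μ : Bel S) : Prop :=
  ‖μ‖ = infNorm μ

/-- `μ` is non-decreasable in its class. -/
def NonDecreasable {S : Set ℂ} (μ : Bel S) : Prop :=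
  ∀ ν ∈ infClass μ, (∀ᵐ z ∂(volume.restrict S), ‖ν z‖ ≤ ‖μ z‖) → μ = ν

/-- `μ` is strongly decreasable in its class; `G` ranges over the (nonempty, open, connected)
subdomains of `S`. -/
def StronglyDecreasable {S : Set ℂ} (μ : Bel S) : Prop :=
  ∃ ν ∈ infClass μ, (∀ᵐ z ∂(volume.restrict S), ‖ν z‖ ≤ ‖μ z‖) ∧
    ∃ G ⊆ S, IsOpen G ∧ IsConnected G ∧
      ∃ δ : ℝ, 0 < δ ∧ ∀ᵐ z ∂(volume.restrict G), ‖ν z‖ ≤ ‖μ z‖ - δ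

/-- `μ` is weakly non-decreasable in its class. -/
def WeaklyNonDecreasable {S : Set ℂ} (μ : Bel S) : Prop :=
  ¬ StronglyDecreasable μ

/-- `μ` is a pseudo non-decreasable dilatation in its class. -/
def PseudoNonDecreasable {S : Set ℂ} (μ : Bel S) : Prop :=
  WeaklyNonDecreasable μ ∧ ¬ NonDecreasable μ

/-- The open unit disk. -/
abbrev unitDisk : Set ℂ := Metric.ball (0 : ℂ) 1

/-!
The differential `μ` has modulus one on the right half `Re z > 0` of the disc and vanishes on the
left half.

On the right half `μ` is rigid. There are `φ n = exp (ψ n)` in `Q unitDisk` which tend to zero on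
the left half, converge to a zero-free `φ` at every point of the right half, and satisfy
`∫ (|φ n| - Re (μ φ n)) → 0` for `μ = conj φ / |φ|` on the right (`exists_reich_sequence`). If `ν`
is equivalent to `μ` and `‖ν‖ ≤ 1`, then `∫ (|φ n| - Re (ν φ n))` is the same integral, with a
nonnegative integrand, and Fatou's lemma gives `Re (ν φ) = |φ|`, that is `ν = μ`, almost everywhere
on the right half (`ae_eq_halfPhase`). So the extremal members of the class are the members of norm
at most one, all of them agree with `μ` on the right, and `μ`, being zero on the left, has the
least modulus among them at almost every point. Therefore `μ` is extremal and non-decreasable, and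
no other extremal member is non-decreasable.

The `φ n` jump from about `0` to about `φ` across the imaginary axis. This is possible because they
are unbounded near the axis: the exponents `ψ n` are sums of polynomials close to `-1` on the left
and to `0` to the right of a thin strip (`exists_cutoff_polynomial`), which exist by Runge's theorem
(`exists_polynomial_near_div`), and each strip is so thin that it contributes little to the
integrals of the functions constructed before it.

On the left half there is freedom. Let `C` be a closed set of positive length without rational
points, and let `h` be `(z - b) / |z - b|` on the circles about `b = -1/2` with radii in `C`, and
zero elsewhere. By Cauchy's theorem `h` annihilates the holomorphic functions
(`integral_circleField_mul_eq_zero`). So `μ + t h` with `0 < |t| ≤ 1` is an extremal member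
different from `μ`, hence decreasable. It is not strongly decreasable: every domain `G` meets the
complement of the circles in a nonempty open set, and there `μ + t h` equals `μ`, whose modulus is
the least possible.
-/

open Polynomial Topology Filter

/-! ### Polynomial approximation -/

/-- Runge's theorem for rational functions: on a compact set whose complement has no bounded
component, every rational function without poles on the set is a uniform limit of polynomials.
In the closure of the polynomials in `C(K, ℂ)` the coordinate function has spectrum `K`, so the
denominator is invertible there by the spectral mapping theorem. -/
theorem exists_polynomial_near_div {K : Set ℂ} (hK : IsCompact K)
    (hcomp : ∀ a ∈ Kᶜ, ¬ Bornology.IsBounded (connectedComponentIn Kᶜ a))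
    (p r : ℂ[X]) (hp : ∀ z ∈ K, p.eval z ≠ 0) {ε : ℝ} (hε : 0 < ε) :
    ∃ q : ℂ[X], ∀ z ∈ K, ‖q.eval z - r.eval z / p.eval z‖ < ε := by
  rcases K.eq_empty_or_nonempty with rfl | hne
  · exact ⟨0, by simp⟩
  have : CompactSpace K := isCompact_iff_compactSpace.mp hK
  have : Nonempty K := hne.to_subtype
  let A : Subalgebra ℂ C(K, ℂ) := (polynomialFunctions K).topologicalClosure
  have hA : IsClosed (A : Set C(K, ℂ)) := Subalgebra.isClosed_topologicalClosure _
  have : CompleteSpace A := hA.completeSpace_coe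
  have hmem (f : ℂ[X]) : f.toContinuousMapOn K ∈ A :=
    Subalgebra.le_topologicalClosure _ ⟨f, by simp⟩
  let x : A := ⟨X.toContinuousMapOn K, hmem X⟩
  have hx : spectrum ℂ (x : C(K, ℂ)) = K := by
    rw [ContinuousMap.spectrum_eq_range]
    ext z
    simp [x]
  -- The spectrum of the coordinate function does not grow in the closed subalgebra, since no
  -- component of the complement of `K` is bounded.
  have hxA : spectrum ℂ x ⊆ K := by
    intro a ha
    by_contra haK
    have := Subalgebra.spectrum_isBounded_connectedComponentIn A x ha
    rw [hx] at this
    exact hcomp a haK this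
  have hunit : IsUnit (aeval x p) := by
    rw [← spectrum.zero_notMem_iff ℂ, spectrum.map_polynomial_aeval]
    rintro ⟨a, ha, h0⟩
    exact hp a (hxA ha) h0
  obtain ⟨u, hu⟩ := hunit
  have hev (f : ℂ[X]) (z : K) : (aeval x f : A).1 z = f.eval z.1 := by
    have : ((aeval x f : A) : C(K, ℂ)) = aeval (x : C(K, ℂ)) f :=
      (Polynomial.aeval_algHom_apply A.val x f).symm
    rw [this, aeval_continuousMap_apply]
    simp [x]
  let y : A := aeval x r * ↑u⁻¹
  have hy (z : K) : y.1 z = r.eval z.1 / p.eval z.1 := by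
    rw [eq_div_iff (hp z z.2), ← hev, ← hev, ← hu]
    have : y * u = aeval x r := by simp [y]
    rw [← this]
    rfl
  obtain ⟨g, hg, hgy⟩ := Metric.mem_closure_iff.mp y.2 ε hε
  obtain ⟨q, -, rfl⟩ := hg
  refine ⟨q, fun z hz => ?_⟩
  have := (ContinuousMap.dist_lt_iff hε).mp hgy ⟨z, hz⟩
  rw [dist_comm, dist_eq_norm, hy] at this
  simpa using this

/-- The closed unit disc with the strip `0 < Re z < δ` removed does not separate the plane: the
strip joins every point between the two pieces to infinity. -/
theorem not_isBounded_connectedComponentIn_compl (δ : ℝ) (a : ℂ)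
    (ha : a ∈ {z : ℂ | ‖z‖ ≤ 1 ∧ (z.re ≤ 0 ∨ δ ≤ z.re)}ᶜ) :
    ¬ Bornology.IsBounded (connectedComponentIn
      {z : ℂ | ‖z‖ ≤ 1 ∧ (z.re ≤ 0 ∨ δ ≤ z.re)}ᶜ a) := by
  -- It is enough to find an unbounded ray through `a`, in direction `v`, that avoids the set.
  have key (v : ℂ) (hv : v ≠ 0) (h : ∀ t : ℝ, 0 ≤ t → a + t * v ∈
      {z : ℂ | ‖z‖ ≤ 1 ∧ (z.re ≤ 0 ∨ δ ≤ z.re)}ᶜ) :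
      ¬ Bornology.IsBounded (connectedComponentIn
        {z : ℂ | ‖z‖ ≤ 1 ∧ (z.re ≤ 0 ∨ δ ≤ z.re)}ᶜ a) := by
    intro hb
    have hsub : (fun t : ℝ => a + t * v) '' Set.Ici 0 ⊆
        connectedComponentIn {z : ℂ | ‖z‖ ≤ 1 ∧ (z.re ≤ 0 ∨ δ ≤ z.re)}ᶜ a := by
      refine IsPreconnected.subset_connectedComponentIn ?_ ⟨0, by simp⟩ ?_
      · exact isPreconnected_Ici.image _ (by fun_prop)
      · rintro _ ⟨t, ht, rfl⟩
        exact h t ht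
    obtain ⟨R, hR⟩ := (hb.subset hsub).exists_norm_le
    have hvpos : 0 < ‖v‖ := norm_pos_iff.mpr hv
    have hR0 : 0 ≤ R := (norm_nonneg _).trans (hR a ⟨0, by simp⟩)
    have h1 := hR _ ⟨(R + ‖a‖ + 1) / ‖v‖, by simp only [Set.mem_Ici]; positivity, rfl⟩
    have h2 : ‖(((R + ‖a‖ + 1) / ‖v‖ : ℝ) : ℂ) * v‖ = R + ‖a‖ + 1 := by
      rw [norm_mul, Complex.norm_real, Real.norm_of_nonneg (by positivity)]
      field_simp
    have h3 := norm_sub_le (a + (((R + ‖a‖ + 1) / ‖v‖ : ℝ) : ℂ) * v) a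
    rw [add_sub_cancel_left, h2] at h3
    linarith
  by_cases h1 : ‖a‖ ≤ 1
  · have h2 : 0 < a.re ∧ a.re < δ := by
      simpa [h1] using ha
    refine key Complex.I Complex.I_ne_zero fun t _ => ?_
    simp [h2.1, h2.2]
  · push Not at h1
    refine key a (by rintro rfl; simp at h1; linarith) fun t ht => ?_
    have : a + t * a = ((1 + t : ℝ) : ℂ) * a := by push_cast; ring
    have h3 : 1 < ‖a + t * a‖ := by
      rw [this, norm_mul, Complex.norm_real, Real.norm_of_nonneg (by positivity)]
      nlinarith
    simp only [Set.mem_compl_iff, Set.mem_ofPred_eq, not_and]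
    intro h
    linarith

theorem norm_one_add_mul_sq (e : ℝ) (z : ℂ) :
    ‖1 + e * z‖ ^ 2 = 1 + 2 * e * z.re + e ^ 2 * ‖z‖ ^ 2 := by
  simp only [Complex.sq_norm, Complex.normSq_apply]
  simp
  ring

/-- A polynomial that is close to `0` on the part `e ≤ Re z` of the closed unit disc and within
`1 / 2` of `-1` on its left half. It approximates `-1 / (1 + w)`, where `w` is a high power of the
square of an affine function that is smaller than one on the left and larger than one on the right. -/
theorem exists_cutoff_polynomial {e : ℝ} (he : 0 < e) :
    ∃ q : ℂ[X], (∀ z : ℂ, ‖z‖ ≤ 1 → e ≤ z.re → ‖q.eval z‖ ≤ e) ∧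
      ∀ z : ℂ, ‖z‖ ≤ 1 → z.re ≤ 0 → ‖q.eval z + 1‖ ≤ 1 / 2 := by
  set K : Set ℂ := {z : ℂ | ‖z‖ ≤ 1 ∧ (z.re ≤ 0 ∨ e ≤ z.re)}
  have hK : IsCompact K := by
    refine (isCompact_closedBall (0 : ℂ) 1).of_isClosed_subset ?_ fun z hz => by simpa using hz.1
    have h1 : IsClosed {z : ℂ | ‖z‖ ≤ 1} := isClosed_le continuous_norm continuous_const
    have h2 : IsClosed {z : ℂ | z.re ≤ 0} := isClosed_le Complex.continuous_re continuous_const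
    have h3 : IsClosed {z : ℂ | e ≤ z.re} := isClosed_le continuous_const Complex.continuous_re
    exact h1.inter (h2.union h3)
  -- The circle `‖1 + e z‖ ^ 2 = D` runs between the two parts of `K`.
  set D : ℝ := 1 + 3 / 2 * e ^ 2 with hD
  have hD0 : 0 < D := by positivity
  obtain ⟨m₁, hm₁⟩ := exists_pow_lt_of_lt_one (show (0 : ℝ) < 1 / 5 by norm_num)
    (show (1 + e ^ 2) / D < 1 by rw [div_lt_one hD0]; nlinarith)
  obtain ⟨m₂, hm₂⟩ := pow_unbounded_of_one_lt (1 + 2 / e)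
    (show 1 < (1 + 2 * e ^ 2) / D by rw [one_lt_div hD0]; nlinarith)
  set m := max m₁ m₂
  let w : ℂ → ℂ := fun z => (((D⁻¹ : ℝ) : ℂ) * (1 + e * z) ^ 2) ^ m
  have hw (z : ℂ) : ‖w z‖ = ((1 + 2 * e * z.re + e ^ 2 * ‖z‖ ^ 2) / D) ^ m := by
    simp only [w]
    rw [norm_pow, norm_mul, norm_pow, norm_one_add_mul_sq, Complex.norm_real,
      Real.norm_of_nonneg (by positivity)]
    congr 1
    field_simp
  have hleft (z : ℂ) (hz : ‖z‖ ≤ 1) (hre : z.re ≤ 0) : ‖w z‖ ≤ 1 / 5 := by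
    rw [hw]
    have h0 : 0 ≤ 1 + 2 * e * z.re + e ^ 2 * ‖z‖ ^ 2 := by
      rw [← norm_one_add_mul_sq]; positivity
    have h1 : 1 + 2 * e * z.re + e ^ 2 * ‖z‖ ^ 2 ≤ 1 + e ^ 2 := by
      have : ‖z‖ ^ 2 ≤ 1 := by nlinarith [norm_nonneg z]
      nlinarith [mul_nonneg he.le (neg_nonneg.mpr hre), sq_nonneg e]
    calc _ ≤ ((1 + e ^ 2) / D) ^ m := by gcongr
      _ ≤ ((1 + e ^ 2) / D) ^ m₁ := by
        refine pow_le_pow_of_le_one (by positivity) ?_ (le_max_left _ _)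
        rw [div_le_one hD0]; nlinarith
      _ ≤ _ := hm₁.le
  have hright (z : ℂ) (hre : e ≤ z.re) : 1 + 2 / e ≤ ‖w z‖ := by
    rw [hw]
    have h1 : 1 + 2 * e ^ 2 ≤ 1 + 2 * e * z.re + e ^ 2 * ‖z‖ ^ 2 := by
      nlinarith [sq_nonneg (e * ‖z‖)]
    calc _ ≤ ((1 + 2 * e ^ 2) / D) ^ m₂ := hm₂.le
      _ ≤ ((1 + 2 * e ^ 2) / D) ^ m := by
        refine pow_le_pow_right₀ ?_ (le_max_right _ _)
        rw [one_le_div hD0]; nlinarith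
      _ ≤ _ := by gcongr
  have hle : ∀ z, 1 - ‖w z‖ ≤ ‖1 + w z‖ ∧ ‖w z‖ - 1 ≤ ‖1 + w z‖ := by
    intro z
    have h1 := norm_sub_norm_le (1 : ℂ) (-w z)
    have h2 := norm_sub_norm_le (w z) (-1 : ℂ)
    simp only [norm_neg, norm_one, sub_neg_eq_add] at h1 h2
    rw [add_comm (w z)] at h2
    exact ⟨h1, h2⟩
  have he2 : 0 < 2 / e := by positivity
  let p : ℂ[X] := 1 + (C ((D⁻¹ : ℝ) : ℂ) * (1 + C (e : ℂ) * X) ^ 2) ^ m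
  have hp (z : ℂ) : p.eval z = 1 + w z := by simp [p, w]
  obtain ⟨q, hq⟩ := exists_polynomial_near_div hK
    (not_isBounded_connectedComponentIn_compl e) p (-1) (by
      rintro z ⟨hz, hre⟩ h0
      have := hle z
      rw [← hp, h0, norm_zero] at this
      rcases hre with hre | hre
      · linarith [hleft z hz hre]
      · linarith [hright z hre]) (ε := min (1 / 4) (e / 2)) (by positivity)
  refine ⟨q, fun z hz hre => ?_, fun z hz hre => ?_⟩
  · have h1 := (hq z ⟨hz, Or.inr hre⟩).le.trans (min_le_right _ _)
    have h2 : ‖(-1 : ℂ[X]).eval z / p.eval z‖ ≤ e / 2 := by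
      rw [hp, norm_div]
      have h3 : 2 / e ≤ ‖1 + w z‖ := by linarith [hright z hre, (hle z).2]
      simp only [eval_neg, eval_one, norm_neg, norm_one]
      calc 1 / ‖1 + w z‖ ≤ 1 / (2 / e) := by gcongr
        _ = e / 2 := by field_simp
    have h4 := norm_add_le (q.eval z - (-1 : ℂ[X]).eval z / p.eval z)
      ((-1 : ℂ[X]).eval z / p.eval z)
    rw [sub_add_cancel] at h4
    linarith
  · have h1 := (hq z ⟨hz, Or.inl hre⟩).le.trans (min_le_left _ _)
    have h5 : 4 / 5 ≤ ‖1 + w z‖ := by linarith [hleft z hz hre, (hle z).1]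
    have h2 : ‖(-1 : ℂ[X]).eval z / p.eval z + 1‖ ≤ 1 / 4 := by
      have hne : 1 + w z ≠ 0 := by
        intro h; rw [h, norm_zero] at h5; linarith
      have : (-1 : ℂ[X]).eval z / p.eval z + 1 = w z / (1 + w z) := by
        rw [hp]; simp only [eval_neg, eval_one]; field_simp; ring
      rw [this, norm_div, div_le_iff₀ (by linarith)]
      linarith [hleft z hz hre]
    have h4 := norm_add_le (q.eval z - (-1 : ℂ[X]).eval z / p.eval z)
      ((-1 : ℂ[X]).eval z / p.eval z + 1)
    rw [← add_assoc, sub_add_cancel] at h4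
    linarith

/-! ### A degenerating Hamilton sequence -/

/-- The exponents of the Hamilton sequence, with scales `e n` that decrease so fast that they beat
the maximum of `|exp (ψ n)|` on the closed unit disc. Passing from `ψ n` to `ψ (n + 1)` changes
little to the right of the strip `0 < Re z < e n`, and lowers the real part by at least `1 / 2` on
the left half disc; what happens inside the strip is controlled by its small area only. -/
theorem exists_exponent_sequence : ∃ (ψ : ℕ → ℂ[X]) (e : ℕ → ℝ), (∀ n, 0 < e n) ∧
    (∀ n, e (n + 1) ≤ e n / 2) ∧ (∀ n, e n ≤ (1 / 2) ^ n) ∧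
    (∀ n z, ‖z‖ ≤ 1 → e n * ‖Complex.exp ((ψ n).eval z)‖ ≤ (1 / 2) ^ n) ∧
    (∀ n z, ‖z‖ ≤ 1 → e n ≤ z.re → ‖(ψ (n + 1)).eval z - (ψ n).eval z‖ ≤ e n) ∧
    ∀ n z, ‖z‖ ≤ 1 → z.re ≤ 0 → ((ψ n).eval z).re ≤ -(n / 2) := by
  have step (s : ℂ[X] × {e : ℝ // 0 < e}) : ∃ t : ℂ[X] × {e : ℝ // 0 < e},
      t.2.1 ≤ s.2.1 / 2 ∧
      (∀ z, ‖z‖ ≤ 1 → t.2.1 * ‖Complex.exp (t.1.eval z)‖ ≤ s.2.1 / 2) ∧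
      (∀ z, ‖z‖ ≤ 1 → s.2.1 ≤ z.re → ‖t.1.eval z - s.1.eval z‖ ≤ s.2.1) ∧
      ∀ z, ‖z‖ ≤ 1 → z.re ≤ 0 → (t.1.eval z).re ≤ (s.1.eval z).re - 1 / 2 := by
    obtain ⟨ψ, e, he⟩ := s
    obtain ⟨q, hq₁, hq₂⟩ := exists_cutoff_polynomial he
    obtain ⟨M, hM⟩ := (isCompact_closedBall (0 : ℂ) 1).exists_bound_of_continuousOn
      (f := fun z => Complex.exp ((ψ + q).eval z)) (by fun_prop)
    have hM1 : 0 < max M 1 := by positivity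
    refine ⟨(ψ + q, ⟨min (e / 2) (e / 2 / max M 1), by positivity⟩), min_le_left _ _,
      fun z hz => ?_, fun z hz hre => ?_, fun z hz hre => ?_⟩
    · calc _ ≤ (e / 2 / max M 1) * max M 1 := by
            gcongr
            · exact min_le_right _ _
            · exact (hM z (by simpa using hz)).trans (le_max_left _ _)
        _ = e / 2 := by field_simp
    · simpa using hq₁ z hz hre
    · have h := (Complex.re_le_norm _).trans (hq₂ z hz hre)
      simp only [eval_add, Complex.add_re, Complex.one_re] at h ⊢
      linarith
  choose next h₁ h₂ h₃ h₄ using step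
  let s : ℕ → ℂ[X] × {e : ℝ // 0 < e} := fun n => Nat.rec (0, ⟨1, one_pos⟩) (fun _ => next) n
  have hs (n : ℕ) : s (n + 1) = next (s n) := rfl
  have hpow (n : ℕ) : (s n).2.1 ≤ (1 / 2) ^ n := by
    induction n with
    | zero => simp [s]
    | succ n ih =>
      rw [hs, pow_succ]
      linarith [h₁ (s n)]
  refine ⟨fun n => (s n).1, fun n => (s n).2.1, fun n => (s n).2.2, fun n => h₁ _, hpow,
    fun n z hz => ?_, fun n => h₃ _, fun n z hz hre => ?_⟩
  · cases n with
    | zero => simp [s]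
    | succ n =>
      refine (h₂ (s n) z hz).trans ?_
      rw [pow_succ]
      linarith [hpow n]
  · induction n with
    | zero => simp [s]
    | succ n ih =>
      have := h₄ (s n) z hz hre
      push_cast
      simp only [hs]
      linarith

theorem one_sub_cos_le_abs (x : ℝ) : 1 - Real.cos x ≤ |x| := by
  rcases le_total |x| 2 with h | h
  · have h1 := Real.one_sub_sq_div_two_le_cos (x := x)
    have h2 := sq_abs x
    nlinarith [abs_nonneg x]
  · linarith [Real.neg_one_le_cos x]

/-- The function of modulus one with phase `-Im f` on the right half plane, and zero elsewhere.
Where `φ = exp f` on the right half plane, it equals `conj φ / |φ|`. -/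
noncomputable def halfPhase (f : ℂ → ℂ) (z : ℂ) : ℂ :=
  if 0 < z.re then Complex.exp (-((f z).im * Complex.I)) else 0

theorem measurable_halfPhase {f : ℂ → ℂ} (hf : Measurable f) : Measurable (halfPhase f) := by
  unfold halfPhase
  refine Measurable.ite ?_ (by fun_prop) measurable_const
  exact measurableSet_lt measurable_const Complex.measurable_re

theorem norm_halfPhase_of_pos {f : ℂ → ℂ} {z : ℂ} (hz : 0 < z.re) : ‖halfPhase f z‖ = 1 := by
  rw [halfPhase, if_pos hz, Complex.norm_exp]
  simp

theorem halfPhase_of_nonpos {f : ℂ → ℂ} {z : ℂ} (hz : z.re ≤ 0) : halfPhase f z = 0 :=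
  if_neg hz.not_gt

theorem norm_halfPhase_le_one (f : ℂ → ℂ) (z : ℂ) : ‖halfPhase f z‖ ≤ 1 := by
  rcases lt_or_ge 0 z.re with hz | hz
  · exact (norm_halfPhase_of_pos hz).le
  · simp [halfPhase_of_nonpos hz]

theorem halfPhase_mul_exp {f : ℂ → ℂ} {z : ℂ} (hz : 0 < z.re) :
    halfPhase f z * Complex.exp (f z) = (‖Complex.exp (f z)‖ : ℂ) := by
  rw [halfPhase, if_pos hz, ← Complex.exp_add, Complex.norm_exp, Complex.ofReal_exp]
  congr 1
  apply Complex.ext <;> simp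

theorem norm_exp_sub_re_halfPhase_mul_exp_le {f : ℂ → ℂ} {z : ℂ} (hz : 0 < z.re) (w : ℂ) :
    ‖Complex.exp w‖ - (halfPhase f z * Complex.exp w).re ≤ ‖Complex.exp w‖ * ‖w - f z‖ := by
  rw [halfPhase, if_pos hz, ← Complex.exp_add, Complex.exp_re, Complex.norm_exp]
  have h1 : (-((f z).im * Complex.I) + w).re = w.re := by simp
  have h2 : (-((f z).im * Complex.I) + w).im = (w - f z).im := by simp; ring
  rw [h1, h2, ← mul_one_sub]
  gcongr
  exact (one_sub_cos_le_abs _).trans (Complex.abs_im_le_norm _)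

theorem volume_strip_le {e : ℝ} (he : 0 < e) :
    (volume.restrict unitDisk).real {z : ℂ | 0 < z.re ∧ z.re < e} ≤ 2 * e := by
  have hsub : {z : ℂ | 0 < z.re ∧ z.re < e} ∩ unitDisk ⊆ Set.Ioo 0 e ×ℂ Set.Ioo (-1) 1 := by
    rintro z ⟨⟨h1, h2⟩, hz⟩
    have h3 := (Complex.abs_im_le_norm z).trans_lt (by simpa using hz)
    exact ⟨⟨h1, h2⟩, abs_lt.mp h3⟩
  have hvol : volume (Set.Ioo 0 e ×ℂ Set.Ioo (-1) 1) = ENNReal.ofReal (2 * e) := by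
    rw [← Complex.volume_preserving_equiv_real_prod.symm.measure_preimage_equiv]
    have : Complex.measurableEquivRealProd.symm ⁻¹' (Set.Ioo 0 e ×ℂ Set.Ioo (-1) 1) =
        Set.Ioo 0 e ×ˢ Set.Ioo (-1) 1 := by
      ext p
      simp [Complex.mem_reProdIm]
    rw [this, Measure.volume_eq_prod, Measure.prod_prod, Real.volume_Ioo, Real.volume_Ioo,
      ← ENNReal.ofReal_mul (by linarith)]
    congr 1
    ring
  rw [measureReal_def, Measure.restrict_apply' measurableSet_ball]
  refine ENNReal.toReal_le_of_le_ofReal (by positivity) ?_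
  rw [← hvol]
  exact measure_mono hsub

/-- There are entire functions `ψ n`, convergent to some `f` on the right half disc, such that
`φ n = exp (ψ n)` satisfies Reich's condition `∫ (|φ n| - Re (μ φ n)) → 0` for the differential
`μ = halfPhase f`, which vanishes on the left half disc. The `φ n` tend to zero on the left, and
are not bounded near the imaginary axis. -/
theorem exists_reich_sequence : ∃ (ψ : ℕ → ℂ → ℂ) (f : ℂ → ℂ), (∀ n, Differentiable ℂ (ψ n)) ∧
    Measurable f ∧ (∀ z ∈ unitDisk, 0 < z.re → Tendsto (fun n => ψ n z) atTop (𝓝 (f z))) ∧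
    Tendsto (fun n => ∫ z in unitDisk,
      (‖Complex.exp (ψ n z)‖ - (halfPhase f z * Complex.exp (ψ n z)).re)) atTop (𝓝 0) := by
  obtain ⟨ψ, e, he, hstep, hpow, hM, hright, hleft⟩ := exists_exponent_sequence
  -- The bound is written in the form that `dist_le_of_le_geometric_two_of_tendsto₀` expects.
  have hgeom (n k : ℕ) : e (n + k) ≤ 2 * e n / 2 / 2 ^ k := by
    induction k with
    | zero => simp
    | succ k ih =>
      have := hstep (n + k)
      rw [pow_succ, ← div_div]
      rw [← add_assoc]
      linarith
  have hanti (n k : ℕ) : e (n + k) ≤ e n := by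
    refine (hgeom n k).trans ?_
    rw [mul_div_cancel_left₀ _ two_ne_zero]
    exact div_le_self (he n).le (one_le_pow₀ one_le_two)
  have hinc (n : ℕ) (z : ℂ) (hz : ‖z‖ ≤ 1) (hre : e n ≤ z.re) (k : ℕ) :
      dist ((ψ (n + k)).eval z) ((ψ (n + (k + 1))).eval z) ≤ 2 * e n / 2 / 2 ^ k := by
    rw [dist_comm, dist_eq_norm]
    exact (hright (n + k) z hz ((hanti n k).trans hre)).trans (hgeom n k)
  have hlim (z : ℂ) : ∃ l, z ∈ unitDisk ∩ {z | 0 < z.re} →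
      Tendsto (fun n => (ψ n).eval z) atTop (𝓝 l) := by
    by_cases hz : z ∈ unitDisk ∩ {z | 0 < z.re}
    · obtain ⟨N, hN⟩ := exists_pow_lt_of_lt_one hz.2 (show (1 / 2 : ℝ) < 1 by norm_num)
      obtain ⟨l, hl⟩ := cauchySeq_tendsto_of_complete (cauchySeq_of_le_geometric_two
        (hinc N z (by simpa using (mem_ball_zero_iff.mp hz.1).le) ((hpow N).trans hN.le)))
      refine ⟨l, fun _ => ?_⟩
      simp_rw [add_comm N] at hl
      exact (tendsto_add_atTop_iff_nat N).mp hl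
    · exact ⟨0, fun h => absurd h hz⟩
  choose g hg using hlim
  have hRmeas : MeasurableSet (unitDisk ∩ {z : ℂ | 0 < z.re}) :=
    measurableSet_ball.inter (measurableSet_lt measurable_const Complex.measurable_re)
  -- Off the right half disc the sequence need not converge; there the limit is set to zero.
  set f := (unitDisk ∩ {z : ℂ | 0 < z.re}).indicator g with hf
  have hfg (z : ℂ) (hz : z ∈ unitDisk) (hre : 0 < z.re) :
      Tendsto (fun n => (ψ n).eval z) atTop (𝓝 (f z)) := by
    rw [hf, Set.indicator_of_mem (show z ∈ unitDisk ∩ {z : ℂ | 0 < z.re} from ⟨hz, hre⟩)]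
    exact hg z ⟨hz, hre⟩
  have hfmeas : Measurable f := by
    refine measurable_of_tendsto_metrizable (f := fun n =>
      (unitDisk ∩ {z : ℂ | 0 < z.re}).indicator fun z => (ψ n).eval z) (fun n => ?_) ?_
    · exact (ψ n).continuous.measurable.indicator hRmeas
    · rw [tendsto_pi_nhds]
      intro z
      by_cases hz : z ∈ unitDisk ∩ {z : ℂ | 0 < z.re}
      · simpa only [Set.indicator_of_mem hz] using hfg z hz.1 hz.2
      · simp only [f, Set.indicator_of_notMem hz, tendsto_const_nhds]
  refine ⟨fun n z => (ψ n).eval z, f, fun n => (ψ n).differentiable, hfmeas, hfg, ?_⟩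
  set G : ℕ → ℂ → ℝ := fun n z => ‖Complex.exp ((ψ n).eval z)‖ -
    (halfPhase f z * Complex.exp ((ψ n).eval z)).re with hG
  have habs (n : ℕ) (z : ℂ) : |(halfPhase f z * Complex.exp ((ψ n).eval z)).re| ≤
      ‖Complex.exp ((ψ n).eval z)‖ := by
    refine (Complex.abs_re_le_norm _).trans ?_
    rw [norm_mul]
    exact mul_le_of_le_one_left (norm_nonneg _) (norm_halfPhase_le_one f z)
  have hG0 (n : ℕ) (z : ℂ) : 0 ≤ G n z := by
    have := (abs_le.mp (habs n z)).2
    simp only [hG]; linarith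
  have hGle (n : ℕ) (z : ℂ) (hz : z ∈ unitDisk) : G n z ≤
      (Real.exp (-(n / 2)) + 2 * (1 / 2) ^ n) +
        {z : ℂ | 0 < z.re ∧ z.re < e n}.indicator (fun _ => 2 * ((1 / 2) ^ n / e n)) z := by
    have hz1 : ‖z‖ ≤ 1 := (mem_ball_zero_iff.mp hz).le
    have hMn : ‖Complex.exp ((ψ n).eval z)‖ ≤ (1 / 2) ^ n / e n := by
      rw [le_div_iff₀ (he n), mul_comm]
      exact hM n z hz1
    -- The three regions: the left half disc, the strip `0 < Re z < e n`, and the rest.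
    rcases le_or_gt z.re 0 with hre | hre
    · rw [Set.indicator_of_notMem (fun h => hre.not_gt h.1)]
      have : G n z ≤ Real.exp (-(n / 2)) := by
        simp only [hG, halfPhase_of_nonpos hre, zero_mul, Complex.zero_re, sub_zero,
          Complex.norm_exp]
        exact Real.exp_le_exp.mpr (hleft n z hz1 hre)
      have : (0 : ℝ) < (1 / 2) ^ n := by positivity
      linarith
    have hexp := Real.exp_pos (-(n / 2))
    rcases lt_or_ge z.re (e n) with hre' | hre'
    · rw [Set.indicator_of_mem (show z ∈ {z : ℂ | 0 < z.re ∧ z.re < e n} from ⟨hre, hre'⟩)]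
      have h1 := (abs_le.mp (habs n z)).1
      have : (0 : ℝ) < (1 / 2) ^ n := by positivity
      simp only [hG]
      linarith
    · rw [Set.indicator_of_notMem (fun h => hre'.not_gt h.2)]
      have hdist : ‖(ψ n).eval z - f z‖ ≤ 2 * e n := by
        rw [← dist_eq_norm]
        refine dist_le_of_le_geometric_two_of_tendsto₀ (hinc n z hz1 hre') ?_
        have := (tendsto_add_atTop_iff_nat n).mpr (hfg z hz hre)
        simpa only [add_comm n] using this
      have h2 := norm_exp_sub_re_halfPhase_mul_exp_le (f := f) hre ((ψ n).eval z)
      have h3 : ‖Complex.exp ((ψ n).eval z)‖ * ‖(ψ n).eval z - f z‖ ≤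
          (1 / 2) ^ n / e n * (2 * e n) := by
        have := he n
        gcongr
      have h4 : (1 / 2 : ℝ) ^ n / e n * (2 * e n) = 2 * (1 / 2) ^ n := by
        have := (he n).ne'
        field_simp
      simp only [hG]
      linarith
  have hfin : IsFiniteMeasure (volume.restrict unitDisk) :=
    ⟨by rw [Measure.restrict_apply_univ]; exact measure_ball_lt_top⟩
  have hstrip (n : ℕ) : MeasurableSet {z : ℂ | 0 < z.re ∧ z.re < e n} :=
    (measurableSet_lt measurable_const Complex.measurable_re).inter
      (measurableSet_lt Complex.measurable_re measurable_const)
  have hint (n : ℕ) : ∫ z in unitDisk, G n z ≤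
      (Real.exp (-(n / 2)) + 2 * (1 / 2) ^ n) * (volume.restrict unitDisk).real Set.univ +
        4 * (1 / 2) ^ n := by
    have hi : Integrable ({z : ℂ | 0 < z.re ∧ z.re < e n}.indicator
        (fun _ => 2 * ((1 / 2 : ℝ) ^ n / e n))) (volume.restrict unitDisk) :=
      (integrable_const _).indicator (hstrip n)
    calc ∫ z in unitDisk, G n z ≤ ∫ z in unitDisk,
          ((Real.exp (-(n / 2)) + 2 * (1 / 2) ^ n) +
            {z : ℂ | 0 < z.re ∧ z.re < e n}.indicator (fun _ => 2 * ((1 / 2) ^ n / e n)) z) := by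
          refine integral_mono_of_nonneg (ae_of_all _ (hG0 n)) ((integrable_const _).add hi) ?_
          filter_upwards [ae_restrict_mem measurableSet_ball] with z hz using hGle n z hz
      _ = (Real.exp (-(n / 2)) + 2 * (1 / 2) ^ n) * (volume.restrict unitDisk).real Set.univ +
          (volume.restrict unitDisk).real {z : ℂ | 0 < z.re ∧ z.re < e n} *
            (2 * ((1 / 2) ^ n / e n)) := by
          rw [integral_add (integrable_const _) hi, integral_indicator_const _ (hstrip n),
            integral_const]
          simp only [smul_eq_mul]
          ring
      _ ≤ (Real.exp (-(n / 2)) + 2 * (1 / 2) ^ n) * (volume.restrict unitDisk).real Set.univ +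
          2 * e n * (2 * ((1 / 2) ^ n / e n)) := by
          have := he n
          gcongr
          exact volume_strip_le (he n)
      _ = _ := by
          have := (he n).ne'
          field_simp
          ring
  refine squeeze_zero (fun n => integral_nonneg (hG0 n)) hint ?_
  have h1 : Tendsto (fun n : ℕ => (1 / 2 : ℝ) ^ n) atTop (𝓝 0) :=
    tendsto_pow_atTop_nhds_zero_of_lt_one (by norm_num) (by norm_num)
  have h2 : Tendsto (fun n : ℕ => Real.exp (-((n : ℝ) / 2))) atTop (𝓝 0) :=
    Real.tendsto_exp_neg_atTop_nhds_zero.comp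
      (tendsto_natCast_atTop_atTop.atTop_div_const two_pos)
  simpa using ((h2.add (h1.const_mul 2)).mul_const _).add (h1.const_mul 4)

/-! ### Annihilators carried by circles -/

/-- A closed set of positive length without rational points: an interval minus a thin open
neighbourhood of the rational numbers. -/
theorem exists_isClosed_volume_pos_forall_rat_notMem :
    ∃ C : Set ℝ, IsClosed C ∧ C ⊆ Set.Icc (1 / 8) (1 / 4) ∧ (∀ q : ℚ, (q : ℝ) ∉ C) ∧
      0 < volume C := by
  have h0 : volume (Set.range ((↑) : ℚ → ℝ)) = 0 := (Set.countable_range _).measure_zero _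
  obtain ⟨O, hO, hOo, hOlt⟩ := (Set.range ((↑) : ℚ → ℝ)).exists_isOpen_lt_of_lt
    (μ := volume) (ENNReal.ofReal (1 / 8)) (by rw [h0]; simp)
  refine ⟨Set.Icc (1 / 8) (1 / 4) \ O, isClosed_Icc.sdiff hOo, Set.sdiff_subset,
    fun q hq => hq.2 (hO ⟨q, rfl⟩), ?_⟩
  refine lt_of_lt_of_le ?_ le_measure_sdiff
  rw [Real.volume_Icc, tsub_pos_iff_lt]
  norm_num at hOlt ⊢
  exact hOlt

/-- The function `z ↦ (z - b) / |z - b|` on the union of the circles about `b` whose radius lies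
in `C`, and zero elsewhere. For `b` itself the value is `0 / 0 = 0`. -/
noncomputable def circleField (b : ℂ) (C : Set ℝ) (z : ℂ) : ℂ :=
  C.indicator (fun _ => (z - b) / ‖z - b‖) ‖z - b‖

theorem circleField_of_notMem {b : ℂ} {C : Set ℝ} {z : ℂ} (h : ‖z - b‖ ∉ C) :
    circleField b C z = 0 := Set.indicator_of_notMem h _

theorem norm_circleField_of_mem {b : ℂ} {C : Set ℝ} {z : ℂ} (h : ‖z - b‖ ∈ C) (h0 : z ≠ b) :
    ‖circleField b C z‖ = 1 := by
  rw [circleField, Set.indicator_of_mem h, norm_div, Complex.norm_real, norm_norm,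
    div_self (norm_ne_zero_iff.mpr (sub_ne_zero.mpr h0))]

theorem norm_circleField_le_one (b : ℂ) (C : Set ℝ) (z : ℂ) : ‖circleField b C z‖ ≤ 1 := by
  by_cases h : ‖z - b‖ ∈ C
  · rw [circleField, Set.indicator_of_mem h, norm_div, Complex.norm_real, norm_norm]
    exact div_self_le_one _
  · simp [circleField_of_notMem h]

theorem measurable_circleField (b : ℂ) {C : Set ℝ} (hC : MeasurableSet C) :
    Measurable (circleField b C) := by
  have h : circleField b C = ((fun z : ℂ => ‖z - b‖) ⁻¹' C).indicator
      (fun z => (z - b) / ‖z - b‖) := by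
    ext z
    by_cases hz : ‖z - b‖ ∈ C
    · rw [circleField, Set.indicator_of_mem hz, Set.indicator_of_mem (by exact hz)]
    · rw [circleField_of_notMem hz, Set.indicator_of_notMem (by exact hz)]
  rw [h]
  exact Measurable.indicator (by fun_prop) ((by fun_prop : Measurable fun z : ℂ => ‖z - b‖) hC)

/-- The union of the circles about `b` with radii in a set of positive length has positive area. -/
theorem volume_norm_sub_preimage_pos {b : ℂ} {C : Set ℝ} (hC : MeasurableSet C)
    (hC0 : C ⊆ Set.Ioi 0) (hpos : 0 < volume C) :
    0 < volume ((fun z : ℂ => ‖z - b‖) ⁻¹' C) := by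
  have hmeas : MeasurableSet ((fun z : ℂ => ‖z‖) ⁻¹' C) := measurable_norm hC
  have htrans : volume ((fun z : ℂ => ‖z - b‖) ⁻¹' C) = volume ((fun z : ℂ => ‖z‖) ⁻¹' C) :=
    (measurePreserving_sub_right volume b).measure_preimage hmeas.nullMeasurableSet
  rw [htrans, pos_iff_ne_zero]
  intro h0
  rw [← lintegral_indicator_one hmeas, ← Complex.lintegral_comp_polarCoord_symm,
    setLIntegral_eq_zero_iff' polarCoord.open_target.measurableSet] at h0
  · have hnull : volume (C ×ˢ Set.Ioo (-Real.pi) Real.pi) = 0 := by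
      refine measure_mono_null ?_ (ae_iff.mp h0)
      rintro ⟨r, θ⟩ ⟨hr, hθ⟩ h
      have hr0 : 0 < r := hC0 hr
      have hmem : Complex.polarCoord.symm (r, θ) ∈ (fun z : ℂ => ‖z‖) ⁻¹' C := by
        rw [Set.mem_preimage, Complex.norm_polarCoord_symm, abs_of_pos hr0]
        exact hr
      have := h ⟨hr0, hθ⟩
      rw [Set.indicator_of_mem hmem] at this
      simp [hr0.not_ge] at this
    rw [Measure.volume_eq_prod, Measure.prod_prod, Real.volume_Ioo] at hnull
    rcases mul_eq_zero.mp hnull with h | h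
    · exact hpos.ne' h
    · rw [ENNReal.ofReal_eq_zero] at h
      linarith [Real.pi_pos]
  · have h1 : Continuous fun p : ℝ × ℝ => Complex.polarCoord.symm p := by
      simp only [Complex.polarCoord_symm_apply]
      fun_prop
    exact ((ENNReal.measurable_ofReal.comp measurable_fst).smul
      ((measurable_one.indicator hmeas).comp h1.measurable)).aemeasurable

/-- Cauchy's theorem on a circle, written as a Fourier coefficient. -/
theorem setIntegral_exp_mul_eq_zero {φ : ℂ → ℂ} {b : ℂ} {r : ℝ} (hr : 0 < r)
    (hφ : DifferentiableOn ℂ φ (Metric.closedBall b r)) :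
    ∫ θ in Set.Ioo (-Real.pi) Real.pi,
      Complex.exp (θ * Complex.I) * φ (b + r * Complex.exp (θ * Complex.I)) = 0 := by
  have h : (∮ z in C(b, r), φ z) = 0 :=
    Complex.circleIntegral_eq_zero_of_differentiable_on_off_countable hr.le
      Set.countable_empty hφ.continuousOn (fun z hz =>
        hφ.differentiableAt (Filter.mem_of_superset (Metric.isOpen_ball.mem_nhds hz.1)
          Metric.ball_subset_closedBall))
  set F : ℝ → ℂ := fun θ =>
    Complex.exp (θ * Complex.I) * φ (b + r * Complex.exp (θ * Complex.I)) with hF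
  have hper : Function.Periodic F (2 * Real.pi) := by
    intro θ
    have : Complex.exp (((θ + 2 * Real.pi : ℝ) : ℂ) * Complex.I) = Complex.exp (θ * Complex.I) := by
      push_cast
      rw [add_mul]
      exact Complex.exp_periodic _
    simp only [hF, this]
  have h2 := hper.intervalIntegral_add_eq (-Real.pi) 0
  rw [← integral_Ioc_eq_integral_Ioo, ← intervalIntegral.integral_of_le (by linarith [Real.pi_pos])]
  rw [show -Real.pi + 2 * Real.pi = Real.pi by ring, zero_add] at h2
  rw [h2]
  have h3 : (∮ z in C(b, r), φ z) = (r * Complex.I) * ∫ θ in (0 : ℝ)..2 * Real.pi, F θ := by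
    rw [circleIntegral, ← intervalIntegral.integral_const_mul]
    congr 1
    ext θ
    simp only [deriv_circleMap, circleMap, hF, smul_eq_mul]
    ring
  rw [h3] at h
  exact (mul_eq_zero.mp h).resolve_left (by simp [hr.ne'])

/-- The function `circleField b C` annihilates every holomorphic function: on each circle about
`b` the integral is a negative Fourier coefficient of a holomorphic function. -/
theorem integral_circleField_mul_eq_zero {φ : ℂ → ℂ} {b : ℂ} {R : ℝ} {C : Set ℝ}
    (hCR : C ⊆ Set.Ioc 0 R)
    (hφ : DifferentiableOn ℂ φ (Metric.closedBall b R)) :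
    ∫ z, circleField b C z * φ z = 0 := by
  rw [← integral_add_left_eq_self _ b, ← Complex.integral_comp_polarCoord_symm]
  -- Without integrability in polar coordinates the integral is zero by convention; otherwise
  -- Fubini's theorem reduces the claim to single circles.
  by_cases hint : IntegrableOn (fun p : ℝ × ℝ => p.1 • (circleField b C
      (b + Complex.polarCoord.symm p) * φ (b + Complex.polarCoord.symm p))) polarCoord.target
  swap
  · exact integral_undef hint
  rw [polarCoord_target, Measure.volume_eq_prod] at hint ⊢
  rw [setIntegral_prod _ hint]
  refine setIntegral_eq_zero_of_forall_eq_zero fun r hr => ?_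
  have hr0 : 0 < r := hr
  have hexp (θ : ℝ) : Complex.polarCoord.symm (r, θ) = r * Complex.exp (θ * Complex.I) := by
    rw [Complex.polarCoord_symm_apply, Complex.exp_mul_I]
    push_cast
    rfl
  have hnorm (θ : ℝ) : ‖(r : ℂ) * Complex.exp (θ * Complex.I)‖ = r := by
    rw [norm_mul, Complex.norm_exp_ofReal_mul_I, Complex.norm_real, Real.norm_of_nonneg hr0.le,
      mul_one]
  simp only [hexp]
  by_cases hrC : r ∈ C
  · have hval (θ : ℝ) : circleField b C (b + r * Complex.exp (θ * Complex.I)) =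
        Complex.exp (θ * Complex.I) := by
      rw [circleField, add_sub_cancel_left, hnorm, Set.indicator_of_mem hrC,
        mul_div_cancel_left₀ _ (by exact_mod_cast hr0.ne')]
    simp only [hval]
    rw [integral_smul, setIntegral_exp_mul_eq_zero hr0
      (hφ.mono (Metric.closedBall_subset_closedBall (hCR hrC).2)), smul_zero]
  · have hval (θ : ℝ) : circleField b C (b + r * Complex.exp (θ * Complex.I)) = 0 := by
      apply circleField_of_notMem
      rwa [add_sub_cancel_left, hnorm]
    simp [hval]

/-- A union of circles about `b` whose radii avoid the rational numbers has empty interior. -/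
theorem exists_mem_norm_sub_notMem {b : ℂ} {C : Set ℝ} (hC : ∀ q : ℚ, (q : ℝ) ∉ C) {G : Set ℂ}
    (hG : IsOpen G) (hne : G.Nonempty) : ∃ z ∈ G, ‖z - b‖ ∉ C := by
  obtain ⟨z, hz⟩ := hne
  by_cases hzb : z = b
  · refine ⟨z, hz, ?_⟩
    simpa [hzb] using hC 0
  have hr : 0 < ‖z - b‖ := norm_pos_iff.mpr (sub_ne_zero.mpr hzb)
  -- Move `z` along the ray from `b` until the radius is rational.
  let γ : ℝ → ℂ := fun t => b + ((t / ‖z - b‖ : ℝ) : ℂ) * (z - b)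
  have hγ : Continuous γ := by fun_prop
  have hγz : γ ‖z - b‖ = z := by
    simp only [γ]
    rw [div_self hr.ne', Complex.ofReal_one, one_mul, add_sub_cancel]
  have hopen : IsOpen (γ ⁻¹' G ∩ Set.Ioi 0) := (hG.preimage hγ).inter isOpen_Ioi
  obtain ⟨q, hqG, hq0⟩ := Rat.denseRange_cast.exists_mem_open hopen
    ⟨‖z - b‖, by simpa [hγz] using hz, hr⟩
  refine ⟨γ q, hqG, ?_⟩
  have : ‖γ q - b‖ = q := by
    simp only [γ, add_sub_cancel_left]
    rw [norm_mul, Complex.norm_real, Real.norm_of_nonneg (div_nonneg (le_of_lt hq0) hr.le)]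
    field_simp
  rw [this]
  exact hC q

/-! ### Infinitesimal equivalence classes -/

theorem Bel.ae_norm_le {S : Set ℂ} (μ : Bel S) : ∀ᵐ z ∂(volume.restrict S), ‖μ z‖ ≤ ‖μ‖ := by
  filter_upwards [enorm_ae_le_eLpNormEssSup μ (volume.restrict S)] with z hz
  rw [Lp.norm_def, eLpNorm_exponent_top, ← toReal_enorm]
  refine ENNReal.toReal_mono ?_ hz
  rw [← eLpNorm_exponent_top]
  exact Lp.eLpNorm_ne_top μ

theorem Bel.norm_le_of_ae_le {μ : Bel unitDisk} {c : ℝ} (hc : 0 ≤ c)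
    (h : ∀ᵐ z ∂(volume.restrict unitDisk), ‖μ z‖ ≤ c) : ‖μ‖ ≤ c := by
  have : IsFiniteMeasure (volume.restrict unitDisk) :=
    ⟨by rw [Measure.restrict_apply_univ]; exact measure_ball_lt_top⟩
  simpa using Lp.norm_le_of_ae_bound hc h

theorem Bel.integrableOn_mul {S : Set ℂ} (μ : Bel S) {φ : ℂ → ℂ} (hφ : φ ∈ Q S) :
    IntegrableOn (fun z => μ z * φ z) S :=
  Integrable.bdd_mul hφ.2 (Lp.aestronglyMeasurable μ) μ.ae_norm_le

theorem mem_infClass_iff {S : Set ℂ} {μ ν : Bel S} :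
    ν ∈ infClass μ ↔ ∀ φ ∈ Q S, ∫ z in S, μ z * φ z = ∫ z in S, ν z * φ z := by
  refine forall₂_congr fun φ hφ => ?_
  simp_rw [sub_mul]
  rw [integral_sub (μ.integrableOn_mul hφ) (ν.integrableOn_mul hφ), sub_eq_zero]

theorem infClass_eq_of_mem {S : Set ℂ} {μ ν : Bel S} (h : ν ∈ infClass μ) :
    infClass ν = infClass μ := by
  ext ρ
  rw [mem_infClass_iff] at h
  simp only [mem_infClass_iff]
  exact forall₂_congr fun φ hφ => by rw [h φ hφ]

theorem mem_infClass_self {S : Set ℂ} (μ : Bel S) : μ ∈ infClass μ :=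
  mem_infClass_iff.mpr fun _ _ => rfl

theorem infNorm_le_norm {S : Set ℂ} {μ ν : Bel S} (h : ν ∈ infClass μ) : infNorm μ ≤ ‖ν‖ :=
  csInf_le ⟨0, by rintro _ ⟨ρ, -, rfl⟩; exact norm_nonneg ρ⟩ ⟨ν, h, rfl⟩

theorem IsExtremal.norm_le_of_mem {S : Set ℂ} {μ ν : Bel S} (hν : IsExtremal ν)
    (h : ν ∈ infClass μ) :
    ‖ν‖ ≤ ‖μ‖ := by
  rw [show ‖ν‖ = infNorm ν from hν]
  exact infNorm_le_norm (infClass_eq_of_mem h ▸ mem_infClass_self μ)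

theorem isExtremal_of_forall_norm_le {S : Set ℂ} {μ : Bel S}
    (h : ∀ ν ∈ infClass μ, ‖μ‖ ≤ ‖ν‖) : IsExtremal μ :=
  le_antisymm (le_csInf ⟨_, μ, mem_infClass_self μ, rfl⟩ (by rintro _ ⟨ν, hν, rfl⟩; exact h ν hν))
    (infNorm_le_norm (mem_infClass_self μ))

theorem exp_mem_Q {ψ : ℂ → ℂ} (hψ : Differentiable ℂ ψ) :
    (fun z => Complex.exp (ψ z)) ∈ Q unitDisk := by
  have h : Differentiable ℂ fun z => Complex.exp (ψ z) := hψ.cexp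
  refine ⟨h.differentiableOn, ?_⟩
  exact (h.continuous.continuousOn.integrableOn_compact
    (isCompact_closedBall (0 : ℂ) 1)).mono_set Metric.ball_subset_closedBall

/-! ### Rigidity on the right half disc -/

/-- Rigidity on the right half disc. The functions `φ n = exp (ψ n)` form a degenerating Hamilton
sequence; Fatou's lemma turns `∫ (|φ n| - Re (ν φ n)) → 0` into the pointwise equality
`Re (ν φ) = |φ|`, which together with `|ν| ≤ 1` determines `ν`. -/
theorem ae_eq_halfPhase {ψ : ℕ → ℂ → ℂ} {f : ℂ → ℂ} (hψ : ∀ n, Differentiable ℂ (ψ n))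
    (hf : Measurable f)
    (hlim : ∀ z ∈ unitDisk, 0 < z.re → Tendsto (fun n => ψ n z) atTop (𝓝 (f z)))
    (hG : Tendsto (fun n => ∫ z in unitDisk,
      (‖Complex.exp (ψ n z)‖ - (halfPhase f z * Complex.exp (ψ n z)).re)) atTop (𝓝 0))
    {ν : Bel unitDisk}
    (hν : ∀ φ ∈ Q unitDisk, ∫ z in unitDisk, halfPhase f z * φ z = ∫ z in unitDisk, ν z * φ z)
    (hnorm : ‖ν‖ ≤ 1) :
    ∀ᵐ z ∂(volume.restrict unitDisk), 0 < z.re → ν z = halfPhase f z := by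
  have hφ (n : ℕ) := exp_mem_Q (hψ n)
  have hν1 : ∀ᵐ z ∂(volume.restrict unitDisk), ‖ν z‖ ≤ 1 :=
    ν.ae_norm_le.mono fun z hz => hz.trans hnorm
  set F : ℕ → ℂ → ℝ := fun n z =>
    ‖Complex.exp (ψ n z)‖ - (ν z * Complex.exp (ψ n z)).re with hF
  have hFint (n : ℕ) : IntegrableOn (F n) unitDisk :=
    (hφ n).2.norm.sub (ν.integrableOn_mul (hφ n)).re
  have hF0 : ∀ᵐ z ∂(volume.restrict unitDisk), ∀ n, 0 ≤ F n z := by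
    filter_upwards [hν1] with z hz n
    have h1 := Complex.re_le_norm (ν z * Complex.exp (ψ n z))
    rw [norm_mul] at h1
    have h2 := mul_le_of_le_one_left (norm_nonneg (Complex.exp (ψ n z))) hz
    simp only [hF]
    linarith
  have hre {g : ℂ → ℂ} {n : ℕ} (hg : IntegrableOn (fun z => g z * Complex.exp (ψ n z)) unitDisk) :
      ∫ z in unitDisk, (‖Complex.exp (ψ n z)‖ - (g z * Complex.exp (ψ n z)).re) =
        (∫ z in unitDisk, ‖Complex.exp (ψ n z)‖) -
          (∫ z in unitDisk, g z * Complex.exp (ψ n z)).re := by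
    have h1 := integral_sub (hφ n).2.norm hg.re
    have h2 := integral_re hg
    simp only [RCLike.re_to_complex] at h1 h2
    rw [h1, h2]
  have hFeq (n : ℕ) : ∫ z in unitDisk, F n z = ∫ z in unitDisk,
      (‖Complex.exp (ψ n z)‖ - (halfPhase f z * Complex.exp (ψ n z)).re) := by
    have hi : IntegrableOn (fun z => halfPhase f z * Complex.exp (ψ n z)) unitDisk :=
      Integrable.bdd_mul (hφ n).2 (measurable_halfPhase hf).aestronglyMeasurable
        (ae_of_all _ (norm_halfPhase_le_one f))
    rw [hre hi, hν _ (hφ n), hre (ν.integrableOn_mul (hφ n))]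
  have hlint : Tendsto (fun n => ∫⁻ z in unitDisk, ENNReal.ofReal (F n z)) atTop (𝓝 0) := by
    have h1 := ENNReal.tendsto_ofReal hG
    rw [ENNReal.ofReal_zero] at h1
    refine h1.congr fun n => ?_
    rw [← hFeq]
    exact ofReal_integral_eq_lintegral_ofReal (hFint n) (hF0.mono fun z hz => hz n)
  have hmeas (n : ℕ) : Measurable fun z => ENNReal.ofReal (F n z) := by
    have h1 : Measurable ν := (Lp.stronglyMeasurable ν).measurable
    have h2 : Measurable fun z => Complex.exp (ψ n z) := (hψ n).cexp.continuous.measurable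
    exact (h2.norm.sub (Complex.measurable_re.comp (h1.mul h2))).ennreal_ofReal
  have hfatou : ∫⁻ z in unitDisk, liminf (fun n => ENNReal.ofReal (F n z)) atTop = 0 := by
    refine le_antisymm ?_ zero_le
    exact (lintegral_liminf_le hmeas).trans hlint.liminf_eq.le
  rw [lintegral_eq_zero_iff (Measurable.liminf hmeas)] at hfatou
  filter_upwards [hfatou, hν1, ae_restrict_mem measurableSet_ball] with z hz hz1 hzD hre0
  have hexp : Tendsto (fun n => Complex.exp (ψ n z)) atTop (𝓝 (Complex.exp (f z))) :=
    (Complex.continuous_exp.tendsto _).comp (hlim z hzD hre0)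
  have hFz : Tendsto (fun n => F n z) atTop
      (𝓝 (‖Complex.exp (f z)‖ - (ν z * Complex.exp (f z)).re)) :=
    hexp.norm.sub ((Complex.continuous_re.tendsto _).comp (hexp.const_mul (ν z)))
  rw [(ENNReal.tendsto_ofReal hFz).liminf_eq, Pi.zero_apply, ENNReal.ofReal_eq_zero] at hz
  have hle : ‖ν z * Complex.exp (f z)‖ ≤ ‖Complex.exp (f z)‖ := by
    rw [norm_mul]
    exact mul_le_of_le_one_left (norm_nonneg _) hz1
  have h1 := Complex.re_le_norm (ν z * Complex.exp (f z))
  have hre_eq : (ν z * Complex.exp (f z)).re = ‖ν z * Complex.exp (f z)‖ := by linarith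
  have hval : ν z * Complex.exp (f z) = (‖Complex.exp (f z)‖ : ℂ) := by
    have h2 := Complex.re_eq_norm.mp hre_eq
    rw [Complex.nonneg_iff] at h2
    apply Complex.ext
    · rw [Complex.ofReal_re]; linarith
    · rw [Complex.ofReal_im, ← h2.2]
  rw [← halfPhase_mul_exp hre0] at hval
  exact mul_right_cancel₀ (Complex.exp_ne_zero _) hval

theorem volume_restrict_ne_zero {S G : Set ℂ} (hG : IsOpen G) (hne : G.Nonempty)
    (hGS : G ⊆ S) : volume.restrict S G ≠ 0 := by
  rw [Measure.restrict_eq_self _ hGS]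
  exact (hG.measure_pos volume hne).ne'

/-! ### The example -/

theorem corollary1 :
    ∃ μ : Bel unitDisk,
      (IsExtremal μ ∧ NonDecreasable μ ∧
        ∀ ν ∈ infClass μ, IsExtremal ν → NonDecreasable ν → ν = μ) ∧
      {ν : Bel unitDisk | ν ∈ infClass μ ∧ IsExtremal ν ∧ PseudoNonDecreasable ν}.Infinite := by
  obtain ⟨ψ, f, hψ, hf, hlim, hG⟩ := exists_reich_sequence
  obtain ⟨C, hCc, hCsub, hCq, hCpos⟩ := exists_isClosed_volume_pos_forall_rat_notMem
  set b : ℂ := -1 / 2 with hb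
  have hbn : ‖b‖ = 1 / 2 := by simp [hb]
  have hCIoc : C ⊆ Set.Ioc 0 (1 / 4) := fun r hr =>
    ⟨lt_of_lt_of_le (by norm_num) (hCsub hr).1, (hCsub hr).2⟩
  -- The circles carrying `circleField b C` lie in the left half disc.
  have hball : Metric.closedBall b (1 / 4) ⊆ unitDisk := by
    refine Metric.closedBall_subset_ball' ?_
    rw [dist_zero_right, hbn]
    norm_num
  have hleft (z : ℂ) (hz : ‖z - b‖ ∈ C) : z.re < 0 := by
    have h1 := (Complex.re_le_norm (z - b)).trans (hCsub hz).2
    have h2 : b.re = -1 / 2 := by simp [hb]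
    rw [Complex.sub_re, h2] at h1
    linarith
  have hleft0 {z : ℂ} (hz : 0 < z.re) : circleField b C z = 0 :=
    circleField_of_notMem fun h => (hleft z h).not_gt hz
  have hm : MemLp (halfPhase f) ⊤ (volume.restrict unitDisk) :=
    memLp_top_of_bound (measurable_halfPhase hf).aestronglyMeasurable 1
      (ae_of_all _ (norm_halfPhase_le_one f))
  have hhm : MemLp (circleField b C) ⊤ (volume.restrict unitDisk) :=
    memLp_top_of_bound (measurable_circleField b hCc.measurableSet).aestronglyMeasurable 1
      (ae_of_all _ (norm_circleField_le_one b C))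
  set μ : Bel unitDisk := hm.toLp _
  set h : Bel unitDisk := hhm.toLp _
  have hμ : μ =ᵐ[volume.restrict unitDisk] halfPhase f := hm.coeFn_toLp
  have hh : h =ᵐ[volume.restrict unitDisk] circleField b C := hhm.coeFn_toLp
  have hμ1 : ‖μ‖ ≤ 1 := by
    refine Bel.norm_le_of_ae_le zero_le_one ?_
    filter_upwards [hμ] with z hz
    rw [hz]
    exact norm_halfPhase_le_one f z
  have hrigid (ν : Bel unitDisk) (hν : ν ∈ infClass μ) (hν1 : ‖ν‖ ≤ 1) :
      ∀ᵐ z ∂(volume.restrict unitDisk), 0 < z.re → ν z = halfPhase f z := by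
    refine ae_eq_halfPhase hψ hf hlim hG (fun φ hφ => ?_) hν1
    rw [← mem_infClass_iff.mp hν φ hφ]
    refine integral_congr_ae ?_
    filter_upwards [hμ] with z hz
    rw [hz]
  -- Among the members of norm at most one, `μ` has the least modulus at almost every point.
  have hmin (ν : Bel unitDisk) (hν : ν ∈ infClass μ) (hν1 : ‖ν‖ ≤ 1) :
      ∀ᵐ z ∂(volume.restrict unitDisk), ‖μ z‖ ≤ ‖ν z‖ := by
    filter_upwards [hrigid ν hν hν1, hμ] with z h1 h2
    rw [h2]
    rcases lt_or_ge 0 z.re with hz | hz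
    · rw [h1 hz]
    · rw [halfPhase_of_nonpos hz, norm_zero]
      exact norm_nonneg _
  have hone (ν : Bel unitDisk) (hν : ν ∈ infClass μ) : 1 ≤ ‖ν‖ := by
    by_contra! hlt
    refine volume_restrict_ne_zero (S := unitDisk) (G := unitDisk ∩ {z : ℂ | 0 < z.re})
      (Metric.isOpen_ball.inter (isOpen_lt continuous_const Complex.continuous_re))
      ⟨1 / 2, by simp [Metric.mem_ball]; norm_num, by simp⟩ Set.inter_subset_left ?_
    refine measure_mono_null ?_ (ae_iff.mp ((hrigid ν hν hlt.le).and ν.ae_norm_le))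
    rintro z ⟨-, hz⟩ ⟨h1, h2⟩
    rw [h1 hz, norm_halfPhase_of_pos hz] at h2
    linarith
  have hext (ν : Bel unitDisk) (hν : ν ∈ infClass μ) (hν1 : ‖ν‖ ≤ 1) : IsExtremal ν :=
    isExtremal_of_forall_norm_le fun ρ hρ =>
      hν1.trans (hone ρ (infClass_eq_of_mem hν ▸ hρ))
  refine ⟨μ, ⟨hext μ (mem_infClass_self μ) hμ1, ?_, ?_⟩, ?_⟩
  · intro ν hν hle
    have hν1 : ‖ν‖ ≤ 1 := by
      refine Bel.norm_le_of_ae_le zero_le_one ?_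
      filter_upwards [hle, μ.ae_norm_le] with z h1 h2
      exact h1.trans (h2.trans hμ1)
    refine Lp.ext ?_
    filter_upwards [hrigid ν hν hν1, hμ, hle] with z h1 h2 h3
    rcases lt_or_ge 0 z.re with hz | hz
    · rw [h2, h1 hz]
    · rw [h2, halfPhase_of_nonpos hz, norm_zero, norm_le_zero_iff] at h3
      rw [h2, h3, halfPhase_of_nonpos hz]
  · intro ν hν hνe hνd
    refine hνd μ (infClass_eq_of_mem hν ▸ mem_infClass_self μ) ?_
    exact hmin ν hν ((hνe.norm_le_of_mem hν).trans hμ1)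
  -- The members `μ + t h` with `0 < |t| ≤ 1` are pairwise different because `h ≠ 0`.
  have hh0 : h ≠ 0 := by
    intro h0
    have hE : (fun z : ℂ => ‖z - b‖) ⁻¹' C ⊆ unitDisk := fun z hz =>
      hball (by rw [Metric.mem_closedBall, dist_eq_norm]; exact (hCsub hz).2)
    refine (volume_norm_sub_preimage_pos (b := b) hCc.measurableSet
      (fun r hr => (hCIoc hr).1) hCpos).ne' ?_
    rw [← Measure.restrict_eq_self volume hE]
    have h1 : circleField b C =ᵐ[volume.restrict unitDisk] 0 := by
      rw [h0] at hh
      exact hh.symm.trans (Lp.coeFn_zero _ _ _)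
    refine measure_mono_null ?_ (ae_iff.mp h1)
    intro z hz h2
    have hzb : z ≠ b := by
      intro hzb
      have := (hCIoc hz).1
      simp [hzb] at this
    have := norm_circleField_of_mem (C := C) hz hzb
    rw [h2] at this
    simp at this
  have hhQ (φ : ℂ → ℂ) (hφ : φ ∈ Q unitDisk) : ∫ z in unitDisk, h z * φ z = 0 := by
    rw [integral_congr_ae (g := fun z => circleField b C z * φ z)
      (by filter_upwards [hh] with z hz; rw [hz]), setIntegral_eq_integral_of_forall_compl_eq_zero]
    · exact integral_circleField_mul_eq_zero hCIoc (hφ.1.mono hball)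
    · intro z hz
      rw [circleField_of_notMem, zero_mul]
      exact fun hzC => hz (hball (by rw [Metric.mem_closedBall, dist_eq_norm]; exact (hCsub hzC).2))
  have hcoe (t : ℂ) : (μ + t • h : Bel unitDisk) =ᵐ[volume.restrict unitDisk]
      fun z => halfPhase f z + t * circleField b C z := by
    filter_upwards [Lp.coeFn_add μ (t • h), Lp.coeFn_smul t h, hμ, hh] with z h1 h2 h3 h4
    rw [h1, Pi.add_apply, h2, Pi.smul_apply, h3, h4, smul_eq_mul]
  have hclass (t : ℂ) : μ + t • h ∈ infClass μ := by
    rw [mem_infClass_iff]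
    intro φ hφ
    have : ∫ z in unitDisk, (μ + t • h : Bel unitDisk) z * φ z =
        ∫ z in unitDisk, (μ z * φ z + t * (h z * φ z)) := by
      refine integral_congr_ae ?_
      filter_upwards [Lp.coeFn_add μ (t • h), Lp.coeFn_smul t h] with z h1 h2
      rw [h1, Pi.add_apply, h2, Pi.smul_apply, smul_eq_mul]
      ring
    rw [this, integral_add (μ.integrableOn_mul hφ) ((h.integrableOn_mul hφ).const_mul t),
      integral_const_mul, hhQ φ hφ, mul_zero, add_zero]
  have hnorm (t : ℂ) (ht : ‖t‖ ≤ 1) : ‖μ + t • h‖ ≤ 1 := by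
    refine Bel.norm_le_of_ae_le zero_le_one ?_
    filter_upwards [hcoe t] with z hz
    rw [hz]
    rcases lt_or_ge 0 z.re with hz | hz
    · rw [hleft0 hz, mul_zero, add_zero, norm_halfPhase_of_pos hz]
    · rw [halfPhase_of_nonpos hz, zero_add, norm_mul]
      exact mul_le_one₀ ht (norm_nonneg _) (norm_circleField_le_one b C z)
  have hpseudo (t : ℂ) (ht : ‖t‖ ≤ 1) (ht0 : t ≠ 0) : PseudoNonDecreasable (μ + t • h) := by
    refine ⟨?_, fun hnd => ?_⟩
    · rintro ⟨ν, hν, hle, G, hGS, hGo, hGc, δ, hδ, hGδ⟩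
      rw [infClass_eq_of_mem (hclass t)] at hν
      have hν1 : ‖ν‖ ≤ 1 := by
        refine Bel.norm_le_of_ae_le zero_le_one ?_
        filter_upwards [hle, (μ + t • h).ae_norm_le] with z h1 h2
        exact h1.trans (h2.trans (hnorm t ht))
      -- Off the circles `μ + t h` has the least possible modulus, and `G` is not contained in
      -- the union of the circles.
      have hopen : IsOpen (G ∩ {z | ‖z - b‖ ∉ C}) :=
        hGo.inter (hCc.isOpen_compl.preimage (by fun_prop : Continuous fun z : ℂ => ‖z - b‖))
      obtain ⟨z₀, hz₀, hz₀C⟩ := exists_mem_norm_sub_notMem (b := b) hCq hGo hGc.nonempty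
      refine volume_restrict_ne_zero (S := G) hopen ⟨z₀, hz₀, hz₀C⟩ Set.inter_subset_left ?_
      have hmin' := ae_restrict_of_ae_restrict_of_subset hGS
        ((hmin ν hν hν1).and ((hcoe t).and hμ))
      refine measure_mono_null ?_ (ae_iff.mp (hGδ.and hmin'))
      rintro z ⟨-, hzC⟩ ⟨h1, h2, h3, h4⟩
      rw [h3] at h1
      simp only [circleField_of_notMem (C := C) hzC] at h1
      rw [mul_zero, add_zero, ← h4] at h1
      linarith
    · have hμν : μ + t • h = μ := by
        refine hnd μ (infClass_eq_of_mem (hclass t) ▸ mem_infClass_self μ) ?_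
        exact hmin _ (hclass t) (hnorm t ht)
      rw [add_eq_left, smul_eq_zero] at hμν
      exact hμν.elim ht0 hh0
  have htn (n : ℕ) : ‖((n : ℂ) + 1)⁻¹‖ ≤ 1 := by
    rw [norm_inv]
    refine inv_le_one_of_one_le₀ ?_
    have : ((n : ℂ) + 1) = ((n + 1 : ℕ) : ℂ) := by push_cast; rfl
    rw [this, Complex.norm_natCast]
    exact_mod_cast Nat.le_add_left 1 n
  refine Set.infinite_of_injective_forall_mem (f := fun n : ℕ => μ + ((n : ℂ) + 1)⁻¹ • h) ?_ ?_
  · intro n m hnm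
    have h1 := smul_left_injective ℂ hh0 (add_left_cancel hnm)
    have h2 := inv_injective h1
    exact_mod_cast add_right_cancel h2
  · intro n
    exact ⟨hclass _, hext _ (hclass _) (hnorm _ (htn n)),
      hpseudo _ (htn n) (inv_ne_zero (Nat.cast_add_one_ne_zero n))⟩
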